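/- Let $\mathcal{P}(3^3)$ be the graph whose vertices are the partitions of $\{1,\ldots,9\}$ into three cells of size three, where two such partitions are adjacent if each cell of one contains exactly one point from each cell of the other. For partitions $\pi,\sigma$, let $\pi\wedge\sigma$ denote their meet, i.e. the partition whose cells are the nonempty intersections of a cell of $\pi$ with a cell of $\sigma$, and let $|\pi\wedge\sigma|$ be its number of cells. If $S$ is an independent set of size $70$ in $\mathcal{P}(3^3)$ and $\pi\in S$, then there are exactly $36$ partitions $\sigma\in S$ with $|\pi\wedge\sigma|=7$, exactly $18$ partitions $\sigma\in S$ with $|\pi\wedge\sigma|=6$, and exactly $15$ partitions $\sigma\in S$ with $|\pi\wedge\sigma|=5$. -/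

import Mathlib

/-- The partitions of a nine-element set into three cells of size three. -/
abbrev TriplePartition : Type :=
  {P : Finpartition (Finset.univ : Finset (Fin 9)) //
    P.parts.card = 3 ∧ ∀ c ∈ P.parts, c.card = 3}

/-- Two such partitions are skew if each cell of one contains exactly one point from each cell
of the other. -/
def TriplePartition.Skew (P Q : TriplePartition) : Prop :=
  ∀ a ∈ P.1.parts, ∀ b ∈ Q.1.parts, (a ∩ b).card = 1

/-- The graph on these partitions in which skew partitions are adjacent. -/
def triplePartitionGraph : SimpleGraph TriplePartition where
  Adj := TriplePartition.Skew
  symm := ⟨fun _ _ h b hb a ha => by rw [Finset.inter_comm]; exact h a ha b hb⟩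
  loopless := ⟨fun P h => by
    obtain ⟨a, ha⟩ : P.1.parts.Nonempty := by
      rw [← Finset.card_pos, P.2.1]; norm_num
    have h1 := h a ha a ha
    rw [Finset.inter_self, P.2.2 a ha] at h1
    omega⟩

/-- The number of cells of the meet (coarsest common refinement) of two partitions. -/
def meetCells (P Q : TriplePartition) : ℕ :=
  (P.1 ⊓ Q.1).parts.card

/-! ### The action of the symmetric group on partitions -/

open scoped Pointwise

/-! The clique-coclique bound is tight here. The symmetric group is transitive on the 280
partitions, so a random translate of a 4-clique meets `S` in 4 · 70/280 = 1 partition on average;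
independence allows at most one, hence every 4-clique meets `S` exactly once
(`card_filter_clique_eq_one`).

The number of cells of the meet classifies ordered pairs of partitions up to the group
(`exists_smul_eq_of_meetCells_eq`). Averaging a clique over the stabilizer of `P` therefore yields a
linear equation in the densities of `S` among the partitions at each meet size from `P`
(`sum_density_clique`). Three cliques, with meet sizes (6,6,6,9), (6,7,7,7) and (5,7,7,9), give the
system in `density_relations`. If `P` lies in `S`, then density 9 vanishes and densities 6, 7, 5 are
1/3, 2/9, 5/9; multiplying by the orbit sizes 54, 162, 27 gives 18, 36, 15. -/

instance : SMul (Equiv.Perm (Fin 9)) TriplePartition where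
  smul g P := ⟨Finpartition.ofExistsUnique (g • P.1.parts) (fun _ _ => Finset.subset_univ _)
      (fun x _ => by
        obtain ⟨t, ⟨ht, hxt⟩, hu⟩ := P.1.existsUnique_mem (Finset.mem_univ (g⁻¹ • x))
        refine ⟨g • t, ⟨Finset.smul_mem_smul_finset ht, Finset.inv_smul_mem_iff.1 hxt⟩, ?_⟩
        rintro s ⟨hs, hxs⟩
        obtain ⟨s, hs', rfl⟩ := Finset.mem_smul_finset.1 hs
        rw [hu s ⟨hs', Finset.inv_smul_mem_iff.2 hxs⟩])
      (fun h => by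
        obtain ⟨s, hs, h0⟩ := Finset.mem_smul_finset.1 h
        rw [Finset.smul_finset_eq_empty] at h0
        subst h0
        exact P.1.bot_notMem hs),
    by
      change (g • P.1.parts).card = 3
      rw [Finset.card_smul_finset, P.2.1],
    by
      change ∀ c ∈ g • P.1.parts, c.card = 3
      intro c hc
      obtain ⟨s, hs, rfl⟩ := Finset.mem_smul_finset.1 hc
      rw [Finset.card_smul_finset, P.2.2 s hs]⟩

namespace TriplePartition

theorem parts_smul (g : Equiv.Perm (Fin 9)) (P : TriplePartition) :
    (g • P).1.parts = g • P.1.parts := rfl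

theorem ext_parts {P Q : TriplePartition} (h : P.1.parts = Q.1.parts) : P = Q :=
  Subtype.ext (Finpartition.ext h)

instance : MulAction (Equiv.Perm (Fin 9)) TriplePartition where
  one_smul P := ext_parts (by rw [parts_smul, one_smul])
  mul_smul g h P := ext_parts (by simp only [parts_smul, mul_smul])

end TriplePartition

/-! ### Labelled partitions and their overlap matrices -/

/-- Labellings of nine points by three labels, each used three times. -/
abbrev Labelling : Type :=
  {b : Fin 9 → Fin 3 // ∀ i, (Finset.univ.filter (b · = i)).card = 3}

namespace Labelling

/-- The points with a given label. -/
def cell (b : Labelling) (i : Fin 3) : Finset (Fin 9) := Finset.univ.filter (b.1 · = i)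

@[simp] theorem mem_cell {b : Labelling} {i : Fin 3} {x : Fin 9} : x ∈ b.cell i ↔ b.1 x = i := by
  simp [cell]

theorem card_cell (b : Labelling) (i : Fin 3) : (b.cell i).card = 3 := b.2 i

theorem cell_nonempty (b : Labelling) (i : Fin 3) : (b.cell i).Nonempty := by
  rw [← Finset.card_pos, card_cell]; norm_num

theorem surjective (b : Labelling) : Function.Surjective b.1 := fun i =>
  (b.cell_nonempty i).imp fun _ => mem_cell.1

theorem cell_injective (b : Labelling) : Function.Injective b.cell := by
  intro i j h
  obtain ⟨x, hx⟩ := b.cell_nonempty i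
  exact (mem_cell.1 hx).symm.trans (mem_cell.1 (h ▸ hx))

/-- The partition into the cells of a labelling. -/
def toPartition (b : Labelling) : TriplePartition :=
  ⟨Finpartition.ofExistsUnique (Finset.univ.image b.cell) (fun _ _ => Finset.subset_univ _)
      (fun x _ => ⟨b.cell (b.1 x), by simp, by simp +contextual⟩)
      (fun h => by
        obtain ⟨i, -, hi⟩ := Finset.mem_image.1 h
        exact (b.cell_nonempty i).ne_empty hi),
    by
      change (Finset.univ.image b.cell).card = 3
      simp [Finset.card_image_of_injective _ b.cell_injective],
    by
      change ∀ c ∈ Finset.univ.image b.cell, c.card = 3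
      simp [card_cell]⟩

theorem parts_toPartition (b : Labelling) :
    b.toPartition.1.parts = Finset.univ.image b.cell := rfl

theorem toPartition_surjective : Function.Surjective toPartition := by
  intro P
  let e := Finset.equivFinOfCardEq P.2.1
  have hm : ∀ x, P.1.part x ∈ P.1.parts := fun x => P.1.part_mem.2 (Finset.mem_univ x)
  have hc : ∀ i, Finset.univ.filter (fun x => e ⟨P.1.part x, hm x⟩ = i) = (e.symm i).1 := by
    intro i
    ext x
    rw [Finset.mem_filter, ← Equiv.eq_symm_apply, Subtype.ext_iff,
      P.1.part_eq_iff_mem (e.symm i).2]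
    simp
  refine ⟨⟨fun x => e ⟨P.1.part x, hm x⟩, fun i => ?_⟩, TriplePartition.ext_parts ?_⟩
  · rw [hc, P.2.2 _ (e.symm i).2]
  · ext c
    simp only [parts_toPartition, cell, hc, Finset.mem_image, Finset.mem_univ, true_and]
    exact ⟨fun ⟨i, hi⟩ => hi ▸ (e.symm i).2, fun h => ⟨e ⟨c, h⟩, by simp⟩⟩

instance : SMul (Equiv.Perm (Fin 9)) Labelling where
  smul g b := ⟨b.1 ∘ g.symm, fun i => by
    refine Eq.trans ?_ (b.2 i)
    exact Finset.card_equiv g.symm (by simp)⟩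

theorem smul_apply (g : Equiv.Perm (Fin 9)) (b : Labelling) (x : Fin 9) :
    (g • b).1 x = b.1 (g.symm x) := rfl

theorem toPartition_smul (g : Equiv.Perm (Fin 9)) (b : Labelling) :
    (g • b).toPartition = g • b.toPartition := by
  refine TriplePartition.ext_parts ?_
  have : ∀ i, (g • b).cell i = g • b.cell i := fun i => by
    ext x
    rw [mem_cell, ← Finset.inv_smul_mem_iff, mem_cell]
    rfl
  rw [TriplePartition.parts_smul, parts_toPartition, parts_toPartition, Finset.smul_finset_def,
    Finset.image_image]
  exact Finset.image_congr fun i _ => this i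

/-- Relabelling by a permutation of the labels. -/
def relabel (s : Equiv.Perm (Fin 3)) (b : Labelling) : Labelling :=
  ⟨s ∘ b.1, fun i => by
    refine Eq.trans ?_ (b.2 (s.symm i))
    congr 1
    ext x
    simp [Equiv.eq_symm_apply]⟩

theorem toPartition_relabel (s : Equiv.Perm (Fin 3)) (b : Labelling) :
    (b.relabel s).toPartition = b.toPartition := by
  refine TriplePartition.ext_parts ?_
  have : (b.relabel s).cell = b.cell ∘ s.symm := by
    ext i x
    simp [relabel, Equiv.eq_symm_apply]
  rw [parts_toPartition, parts_toPartition, this, ← Finset.image_image,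
    Finset.image_univ_equiv]

theorem toPartition_eq_iff {a b : Labelling} :
    a.toPartition = b.toPartition ↔ ∃ s, a = b.relabel s := by
  refine ⟨fun h => ?_, fun ⟨s, hs⟩ => hs ▸ toPartition_relabel s b⟩
  have hp : Finset.univ.image a.cell = Finset.univ.image b.cell := by
    rw [← parts_toPartition, ← parts_toPartition, h]
  have hb : ∀ i, ∃ j, a.cell j = b.cell i := fun i => by
    have : b.cell i ∈ Finset.univ.image a.cell := hp ▸ Finset.mem_image_of_mem _ (Finset.mem_univ i)
    simpa using this
  choose s hs using hb
  have hinj : Function.Injective s := fun i j hij => b.cell_injective (by rw [← hs, hij, hs])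
  refine ⟨Equiv.ofBijective s (Finite.injective_iff_bijective.1 hinj), Subtype.ext (funext fun x => ?_)⟩
  have : x ∈ a.cell (s (b.1 x)) := by rw [hs]; simp
  exact mem_cell.1 this

theorem relabel_injective (b : Labelling) : Function.Injective (b.relabel ·) := by
  intro s t h
  refine Equiv.ext fun i => ?_
  obtain ⟨x, rfl⟩ := b.surjective i
  exact congrFun (congrArg Subtype.val h) x

theorem card_fiber_toPartition (P : TriplePartition) :
    (Finset.univ.filter fun b : Labelling => b.toPartition = P).card = 6 := by
  obtain ⟨b, rfl⟩ := toPartition_surjective P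
  have : (Finset.univ.filter fun a : Labelling => a.toPartition = b.toPartition) =
      Finset.univ.image (b.relabel ·) := by
    ext a
    simp only [toPartition_eq_iff, Finset.mem_filter, Finset.mem_image, Finset.mem_univ, true_and]
    exact exists_congr fun _ => eq_comm
  rw [this, Finset.card_image_of_injective _ b.relabel_injective, Finset.card_univ,
    Fintype.card_perm, Fintype.card_fin]
  rfl

/-- The number of points with given labels in two labellings. -/
def overlap (a b : Labelling) (i j : Fin 3) : ℕ :=
  (Finset.univ.filter fun x => (a.1 x, b.1 x) = (i, j)).card

theorem overlap_eq (a b : Labelling) (i j : Fin 3) :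
    overlap a b i j = (a.cell i ∩ b.cell j).card := by
  rw [overlap]
  congr 1
  ext x
  simp

theorem skew_iff {a b : Labelling} :
    a.toPartition.Skew b.toPartition ↔ ∀ i j, overlap a b i j = 1 := by
  simp [TriplePartition.Skew, parts_toPartition, overlap_eq]

theorem meetCells_toPartition (a b : Labelling) :
    meetCells a.toPartition b.toPartition =
      (Finset.univ.image fun x => (a.1 x, b.1 x)).card := by
  rw [meetCells, Finpartition.parts_inf, parts_toPartition, parts_toPartition]
  symm
  refine Finset.card_bij (fun ij _ => a.cell ij.1 ∩ b.cell ij.2) ?_ ?_ ?_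
  · intro ij h
    obtain ⟨x, -, rfl⟩ := Finset.mem_image.1 h
    refine Finset.mem_erase.2 ⟨?_, Finset.mem_image.2
      ⟨(a.cell (a.1 x), b.cell (b.1 x)), by simp, rfl⟩⟩
    exact Finset.ne_empty_of_mem (a := x) (by simp)
  · intro ij h kl _ he
    obtain ⟨x, -, rfl⟩ := Finset.mem_image.1 h
    have : x ∈ a.cell kl.1 ∩ b.cell kl.2 := by rw [← he]; simp
    simpa [Prod.ext_iff] using this
  · intro c hc
    obtain ⟨hne, hc⟩ := Finset.mem_erase.1 hc
    obtain ⟨⟨p, q⟩, hpq, rfl⟩ := Finset.mem_image.1 hc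
    obtain ⟨hp, hq⟩ := Finset.mem_product.1 hpq
    obtain ⟨i, -, rfl⟩ := Finset.mem_image.1 hp
    obtain ⟨j, -, rfl⟩ := Finset.mem_image.1 hq
    obtain ⟨x, hx⟩ := Finset.nonempty_iff_ne_empty.2 hne
    refine ⟨(i, j), Finset.mem_image.2 ⟨x, Finset.mem_univ _, ?_⟩, rfl⟩
    simpa using hx

theorem meetCells_eq_support (a b : Labelling) :
    meetCells a.toPartition b.toPartition =
      (Finset.univ.filter fun ij : Fin 3 × Fin 3 => overlap a b ij.1 ij.2 ≠ 0).card := by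
  rw [meetCells_toPartition]
  congr 1
  ext ij
  simp [overlap, Finset.filter_eq_empty_iff]

theorem sum_overlap_right (a b : Labelling) (i : Fin 3) : ∑ j, overlap a b i j = 3 := by
  refine Eq.trans ?_ (a.card_cell i)
  rw [Finset.card_eq_sum_card_fiberwise (f := b.1) (t := Finset.univ) (by simp)]
  refine Finset.sum_congr rfl fun j _ => ?_
  rw [overlap]
  congr 1
  ext x
  simp

theorem overlap_comm (a b : Labelling) (i j : Fin 3) : overlap a b i j = overlap b a j i := by
  rw [overlap_eq, overlap_eq, Finset.inter_comm]

theorem sum_overlap_left (a b : Labelling) (j : Fin 3) : ∑ i, overlap a b i j = 3 := by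
  simp_rw [overlap_comm a b]
  exact sum_overlap_right b a j

theorem overlap_relabel (a b : Labelling) (s t : Equiv.Perm (Fin 3)) (i j : Fin 3) :
    overlap (a.relabel s) (b.relabel t) i j = overlap a b (s.symm i) (t.symm j) := by
  simp [overlap, relabel, Equiv.eq_symm_apply]

theorem overlap_smul (g : Equiv.Perm (Fin 9)) (a b : Labelling) (i j : Fin 3) :
    overlap (g • a) (g • b) i j = overlap a b i j :=
  Finset.card_equiv g.symm (by simp [smul_apply])

/-- Two pairs of labellings with the same overlaps differ by a permutation of the points. -/
theorem exists_smul_eq_of_overlap_eq {a b c d : Labelling} (h : overlap a b = overlap c d) :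
    ∃ g : Equiv.Perm (Fin 9), g • a = c ∧ g • b = d := by
  have e : ∀ ij : Fin 3 × Fin 3,
      Nonempty ({x // (c.1 x, d.1 x) = ij} ≃ {x // (a.1 x, b.1 x) = ij}) := fun ij => by
    refine ⟨Fintype.equivOfCardEq ?_⟩
    rw [Fintype.card_subtype, Fintype.card_subtype]
    exact (congrFun (congrFun h ij.1) ij.2).symm
  let g := Equiv.ofFiberEquiv fun ij => (e ij).some
  have hg : ∀ x, (a.1 (g x), b.1 (g x)) = (c.1 x, d.1 x) := fun x =>
    Equiv.ofFiberEquiv_map (f := fun x => (c.1 x, d.1 x)) (g := fun x => (a.1 x, b.1 x))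
      (fun ij => (e ij).some) x
  exact ⟨g.symm, Subtype.ext (funext fun x => congrArg Prod.fst (hg x)),
    Subtype.ext (funext fun x => congrArg Prod.snd (hg x))⟩

end Labelling
-- Normal forms of overlap matrices
namespace Labelling

/-- A `3 × 3` matrix representing the overlaps of two labellings whose partitions have a meet with
`k` cells. -/
def normalOverlap : ℕ → Fin 3 → Fin 3 → ℕ
  | 3 => ![![3, 0, 0], ![0, 3, 0], ![0, 0, 3]]
  | 5 => ![![3, 0, 0], ![0, 2, 1], ![0, 1, 2]]
  | 6 => ![![2, 1, 0], ![0, 2, 1], ![1, 0, 2]]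
  | 7 => ![![2, 1, 0], ![1, 1, 1], ![0, 1, 2]]
  -- The default is meant for 9; no matrix with all row and column sums 3 has another support size.
  | _ => ![![1, 1, 1], ![1, 1, 1], ![1, 1, 1]]

/-- The line sums make the upper left 2 × 2 block determine the matrix, leaving 256 cases. Blocks
for which a subtraction truncates violate the sum hypotheses. -/
theorem exists_perm_eq_normalOverlap_aux : ∀ p q r s : Fin 4,
    let m : Fin 3 → Fin 3 → ℕ := ![![p.1, q.1, 3 - p.1 - q.1], ![r.1, s.1, 3 - r.1 - s.1],
      ![3 - p.1 - r.1, 3 - q.1 - s.1, p.1 + q.1 + r.1 + s.1 - 3]]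
    (∀ i, ∑ j, m i j = 3) → (∀ j, ∑ i, m i j = 3) →
    ∃ s t : Equiv.Perm (Fin 3), ∀ i j, m (s i) (t j) =
      normalOverlap (Finset.univ.filter fun ij : Fin 3 × Fin 3 => m ij.1 ij.2 ≠ 0).card i j := by
  decide +kernel

theorem exists_perm_eq_normalOverlap (m : Fin 3 → Fin 3 → ℕ) (hr : ∀ i, ∑ j, m i j = 3)
    (hc : ∀ j, ∑ i, m i j = 3) :
    ∃ s t : Equiv.Perm (Fin 3), ∀ i j, m (s i) (t j) =
      normalOverlap (Finset.univ.filter fun ij : Fin 3 × Fin 3 => m ij.1 ij.2 ≠ 0).card i j := by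
  have hr' := hr
  have hc' := hc
  simp only [Fin.forall_fin_succ, Fin.sum_univ_succ, Fin.sum_univ_zero, Fin.succ_zero_eq_one,
    Fin.succ_one_eq_two, IsEmpty.forall_iff, and_true, add_zero] at hr' hc'
  obtain ⟨r0, r1, r2⟩ := hr'
  obtain ⟨c0, c1, c2⟩ := hc'
  have key := exists_perm_eq_normalOverlap_aux ⟨m 0 0, by omega⟩ ⟨m 0 1, by omega⟩
    ⟨m 1 0, by omega⟩ ⟨m 1 1, by omega⟩
  have hm : m = ![![m 0 0, m 0 1, 3 - m 0 0 - m 0 1], ![m 1 0, m 1 1, 3 - m 1 0 - m 1 1],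
      ![3 - m 0 0 - m 1 0, 3 - m 0 1 - m 1 1, m 0 0 + m 0 1 + m 1 0 + m 1 1 - 3]] := by
    funext i j
    fin_cases i <;> fin_cases j <;> simp <;> omega
  simp only [] at key
  rw [← hm] at key
  exact key hr hc

theorem exists_normal_labelling (P Q : TriplePartition) :
    ∃ a b : Labelling, a.toPartition = P ∧ b.toPartition = Q ∧
      overlap a b = normalOverlap (meetCells P Q) := by
  obtain ⟨a, rfl⟩ := toPartition_surjective P
  obtain ⟨b, rfl⟩ := toPartition_surjective Q
  obtain ⟨s, t, h⟩ := exists_perm_eq_normalOverlap (overlap a b) (sum_overlap_right a b)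
    (sum_overlap_left a b)
  refine ⟨a.relabel s.symm, b.relabel t.symm, toPartition_relabel _ _, toPartition_relabel _ _, ?_⟩
  funext i j
  rw [overlap_relabel, meetCells_eq_support]
  exact h i j

end Labelling

/-! ### Orbits on pairs of partitions -/

namespace TriplePartition
open Labelling

/-- Both pairs can be labelled so as to have the same normal overlap matrix, and equal overlaps give
a permutation of the points. -/
theorem exists_smul_eq_of_meetCells_eq {P Q P' Q' : TriplePartition}
    (h : meetCells P Q = meetCells P' Q') :
    ∃ g : Equiv.Perm (Fin 9), g • P = P' ∧ g • Q = Q' := by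
  obtain ⟨a, b, rfl, rfl, hab⟩ := exists_normal_labelling P Q
  obtain ⟨c, d, rfl, rfl, hcd⟩ := exists_normal_labelling P' Q'
  obtain ⟨g, rfl, rfl⟩ := exists_smul_eq_of_overlap_eq (hab.trans ((congrArg _ h).trans hcd.symm))
  exact ⟨g, (toPartition_smul g a).symm, (toPartition_smul g b).symm⟩

theorem meetCells_smul (g : Equiv.Perm (Fin 9)) (P Q : TriplePartition) :
    meetCells (g • P) (g • Q) = meetCells P Q := by
  obtain ⟨a, rfl⟩ := toPartition_surjective P
  obtain ⟨b, rfl⟩ := toPartition_surjective Q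
  rw [← toPartition_smul, ← toPartition_smul, meetCells_eq_support, meetCells_eq_support]
  simp_rw [overlap_smul]

theorem skew_smul_iff {g : Equiv.Perm (Fin 9)} {P Q : TriplePartition} :
    (g • P).Skew (g • Q) ↔ P.Skew Q := by
  obtain ⟨a, rfl⟩ := toPartition_surjective P
  obtain ⟨b, rfl⟩ := toPartition_surjective Q
  rw [← toPartition_smul, ← toPartition_smul, skew_iff, skew_iff]
  simp_rw [overlap_smul]

theorem meetCells_self (P : TriplePartition) : meetCells P P = 3 := by
  rw [meetCells, inf_idem, P.2.1]

theorem meetCells_eq_nine_iff_skew {P Q : TriplePartition} : meetCells P Q = 9 ↔ P.Skew Q := by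
  obtain ⟨a, rfl⟩ := toPartition_surjective P
  obtain ⟨b, rfl⟩ := toPartition_surjective Q
  constructor
  · intro h
    obtain ⟨c, d, hc, hd, hcd⟩ := exists_normal_labelling a.toPartition b.toPartition
    rw [← hc, ← hd, skew_iff, hcd, h]
    decide
  · intro h
    rw [meetCells_eq_support]
    simp_rw [skew_iff.1 h]
    rfl

instance : MulAction.IsPretransitive (Equiv.Perm (Fin 9)) TriplePartition where
  exists_smul_eq P Q := by
    obtain ⟨g, hg, -⟩ := exists_smul_eq_of_meetCells_eq
      ((meetCells_self P).trans (meetCells_self Q).symm)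
    exact ⟨g, hg⟩

/-- The orbits of the stabilizer of a partition are given by the number of cells of the meet. -/
theorem mem_orbit_stabilizer_iff {P Q R : TriplePartition} :
    R ∈ MulAction.orbit (MulAction.stabilizer (Equiv.Perm (Fin 9)) P) Q ↔
      meetCells P R = meetCells P Q := by
  constructor
  · rintro ⟨⟨h, hh⟩, rfl⟩
    have : h • P = P := hh
    calc meetCells P (h • Q) = meetCells (h • P) (h • Q) := by rw [this]
      _ = _ := meetCells_smul h P Q
  · intro h
    obtain ⟨g, hg, rfl⟩ := exists_smul_eq_of_meetCells_eq h.symm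
    exact ⟨⟨g, hg⟩, rfl⟩

end TriplePartition
-- Counting partitions by meet size
namespace Labelling

/-- The labelling whose cells are three consecutive intervals. -/
def base : Labelling := ⟨![0, 0, 0, 1, 1, 1, 2, 2, 2], by decide⟩

/-- The labels of three consecutive points. -/
abbrev Row : Type := Fin 3 × Fin 3 × Fin 3

/-- The number of occurrences of a label. -/
def Row.count (r : Row) (j : Fin 3) : ℕ :=
  (if r.1 = j then 1 else 0) + (if r.2.1 = j then 1 else 0) + (if r.2.2 = j then 1 else 0)

/-- The numbers of occurrences of all labels, as the digits of one number. -/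
def Row.weight (r : Row) : ℕ := 10 ^ r.1.1 + 10 ^ r.2.1.1 + 10 ^ r.2.2.1

/-- The number of distinct labels. -/
def Row.support (r : Row) : ℕ :=
  (if r.1 = r.2.1 then 0 else 1) + (if r.2.2 = r.1 ∨ r.2.2 = r.2.1 then 0 else 1) + 1

theorem Row.weight_eq : ∀ r : Row,
    r.weight = r.count 0 + 10 * r.count 1 + 100 * r.count 2 := by decide

theorem Row.sum_count : ∀ r : Row, r.count 0 + r.count 1 + r.count 2 = 3 := by decide

theorem Row.support_eq : ∀ r : Row,
    r.support = (if r.count 0 ≠ 0 then 1 else 0) + (if r.count 1 ≠ 0 then 1 else 0) +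
      (if r.count 2 ≠ 0 then 1 else 0) := by decide

/-- A sum over all rows, grouped by weight. -/
def Row.sumByWeight (f : ℕ → ℕ → ℕ) : ℕ :=
  f 3 1 + f 30 1 + f 300 1 +
    3 * (f 12 2 + f 21 2 + f 102 2 + f 201 2 + f 120 2 + f 210 2) + 6 * f 111 3

/-- The 27 rows have only ten weights, and the weight determines the support. Grouping cuts a sum
over three rows to 1000 terms, which the kernel can evaluate. -/
theorem Row.sum_eq_sumByWeight (f : ℕ → ℕ → ℕ) :
    ∑ r : Row, f r.weight r.support = Row.sumByWeight f := by
  simp [Fintype.sum_prod_type, Fin.sum_univ_three, Row.weight, Row.support, Row.sumByWeight]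
  ring

/-- The labels of nine points, in three rows. -/
def rows (b : Fin 9 → Fin 3) : Row × Row × Row :=
  ((b 0, b 1, b 2), (b 3, b 4, b 5), (b 6, b 7, b 8))

theorem rows_bijective : Function.Bijective rows := by
  constructor
  · intro b c h
    simp only [rows, Prod.mk.injEq] at h
    funext i
    fin_cases i <;> simp_all
  · rintro ⟨⟨a, b, c⟩, ⟨d, e, f⟩, ⟨g, h, i⟩⟩
    exact ⟨![a, b, c, d, e, f, g, h, i], rfl⟩

/-- The label counts total 9, so adding weights in base ten never carries and 333 encodes three
occurrences of each label. -/
theorem balanced_iff (b : Fin 9 → Fin 3) :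
    (∀ i, (Finset.univ.filter (b · = i)).card = 3) ↔
      (rows b).1.weight + (rows b).2.1.weight + (rows b).2.2.weight = 333 := by
  have h : ∀ i, (Finset.univ.filter (b · = i)).card =
      (rows b).1.count i + (rows b).2.1.count i + (rows b).2.2.count i := fun i => by
    simp only [Finset.card_filter, Fin.sum_univ_succ, rows, Row.count]
    simp only [Fin.sum_univ_zero]
    ring_nf; rfl
  have h1 := (rows b).1.sum_count
  have h2 := (rows b).2.1.sum_count
  have h3 := (rows b).2.2.sum_count
  simp only [h, Row.weight_eq, Fin.forall_fin_succ, IsEmpty.forall_iff, and_true,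
    Fin.succ_zero_eq_one, Fin.succ_one_eq_two]
  omega

theorem meetCells_base (b : Labelling) : meetCells base.toPartition b.toPartition =
    (rows b.1).1.support + (rows b.1).2.1.support + (rows b.1).2.2.support := by
  have h0 : ∀ j, overlap base b 0 j = (rows b.1).1.count j := fun j => by
    simp only [overlap, Finset.card_filter, Prod.mk.injEq]
    simp [Fin.sum_univ_succ, rows, Row.count, base, -Finset.sum_boole]
    ring_nf; rfl
  have h1 : ∀ j, overlap base b 1 j = (rows b.1).2.1.count j := fun j => by
    simp only [overlap, Finset.card_filter, Prod.mk.injEq]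
    simp [Fin.sum_univ_succ, rows, Row.count, base, -Finset.sum_boole]
    ring_nf; rfl
  have h2 : ∀ j, overlap base b 2 j = (rows b.1).2.2.count j := fun j => by
    simp only [overlap, Finset.card_filter, Prod.mk.injEq]
    simp [Fin.sum_univ_succ, rows, Row.count, base, -Finset.sum_boole]
    ring_nf; rfl
  rw [meetCells_eq_support, Finset.card_filter, Fintype.sum_prod_type]
  simp only [Fin.sum_univ_three, h0, h1, h2, Row.support_eq]

theorem card_filter_meetCells_base (p : ℕ → Prop) [DecidablePred p] :
    (Finset.univ.filter fun b : Labelling =>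
      p (meetCells base.toPartition b.toPartition)).card =
    (Finset.univ.filter fun t : Row × Row × Row =>
      t.1.weight + t.2.1.weight + t.2.2.weight = 333 ∧
        p (t.1.support + t.2.1.support + t.2.2.support)).card := by
  refine Finset.card_bij (fun b _ => rows b.1) ?_ ?_ ?_
  · intro b hb
    rw [Finset.mem_filter, meetCells_base] at hb
    exact Finset.mem_filter.2 ⟨Finset.mem_univ _, (balanced_iff b.1).1 b.2, hb.2⟩
  · intro b _ c _ h
    exact Subtype.ext (rows_bijective.1 h)
  · intro t ht
    obtain ⟨b, rfl⟩ := rows_bijective.2 t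
    obtain ⟨-, hb, hp⟩ := Finset.mem_filter.1 ht
    refine ⟨⟨b, (balanced_iff b).2 hb⟩, ?_, rfl⟩
    rw [Finset.mem_filter, meetCells_base]
    exact ⟨Finset.mem_univ _, hp⟩

end Labelling

namespace TriplePartition
open Labelling

/-- Each partition has 3! labellings. -/
theorem six_mul_card_filter (p : TriplePartition → Prop) [DecidablePred p] :
    6 * (Finset.univ.filter p).card =
      (Finset.univ.filter fun b : Labelling => p b.toPartition).card := by
  rw [Finset.card_eq_sum_card_fiberwise (f := toPartition) (t := Finset.univ.filter p)
    (fun b hb => by simpa using hb), mul_comm, ← smul_eq_mul, ← Finset.sum_const]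
  refine Finset.sum_congr rfl fun P hP => ?_
  rw [← card_fiber_toPartition P, Finset.filter_filter]
  congr 1
  ext b
  simp only [Finset.mem_filter, Finset.mem_univ, true_and] at hP ⊢
  exact ⟨fun h => ⟨h ▸ hP, h⟩, And.right⟩

theorem six_mul_card_filter_meetCells (p : ℕ → Prop) [DecidablePred p] (P : TriplePartition) :
    6 * (Finset.univ.filter fun Q => p (meetCells P Q)).card =
      Row.sumByWeight fun u i => Row.sumByWeight fun v j => Row.sumByWeight fun w k =>
        if u + v + w = 333 ∧ p (i + j + k) then 1 else 0 := by
  obtain ⟨g, rfl⟩ := MulAction.exists_smul_eq (Equiv.Perm (Fin 9)) base.toPartition P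
  simp only [← Row.sum_eq_sumByWeight]
  trans (Finset.univ.filter fun t : Row × Row × Row =>
    t.1.weight + t.2.1.weight + t.2.2.weight = 333 ∧
      p (t.1.support + t.2.1.support + t.2.2.support)).card
  swap
  · rw [Finset.card_filter, Fintype.sum_prod_type]
    simp only [Fintype.sum_prod_type (α₁ := Row) (α₂ := Row)]
  rw [← card_filter_meetCells_base, ← six_mul_card_filter fun Q => p (meetCells base.toPartition Q)]
  refine congrArg (6 * ·) ?_
  refine (Finset.card_equiv (MulAction.toPerm g) fun Q => ?_).symm
  simp only [Finset.mem_filter, Finset.mem_univ, true_and, MulAction.toPerm_apply, meetCells_smul]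

theorem card_meetCells_eq_five (P : TriplePartition) :
    (Finset.univ.filter fun Q => meetCells P Q = 5).card = 27 := by
  refine Nat.eq_of_mul_eq_mul_left (show 0 < 6 by norm_num)
    ((six_mul_card_filter_meetCells (· = 5) P).trans ?_)
  decide +kernel

theorem card_meetCells_eq_six (P : TriplePartition) :
    (Finset.univ.filter fun Q => meetCells P Q = 6).card = 54 := by
  refine Nat.eq_of_mul_eq_mul_left (show 0 < 6 by norm_num)
    ((six_mul_card_filter_meetCells (· = 6) P).trans ?_)
  decide +kernel

theorem card_meetCells_eq_seven (P : TriplePartition) :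
    (Finset.univ.filter fun Q => meetCells P Q = 7).card = 162 := by
  refine Nat.eq_of_mul_eq_mul_left (show 0 < 6 by norm_num)
    ((six_mul_card_filter_meetCells (· = 7) P).trans ?_)
  decide +kernel

theorem card_meetCells_ne_seven (P : TriplePartition) :
    (Finset.univ.filter fun Q => ¬ meetCells P Q = 7).card = 118 := by
  refine Nat.eq_of_mul_eq_mul_left (show 0 < 6 by norm_num)
    ((six_mul_card_filter_meetCells (¬ · = 7) P).trans ?_)
  decide +kernel

theorem _root_.Fintype.card_eq_card_filter_add_card_filter_not {α : Type*} [Fintype α] (f : α → ℕ)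
    (k : ℕ) : Fintype.card α = (Finset.univ.filter fun x => f x = k).card +
      (Finset.univ.filter fun x => ¬ f x = k).card := by
  rw [Finset.card_filter_add_card_filter_not, Finset.card_univ]

theorem card_eq : Fintype.card TriplePartition = 280 := by
  rw [Fintype.card_eq_card_filter_add_card_filter_not (meetCells base.toPartition) 7,
    card_meetCells_eq_seven, card_meetCells_ne_seven]

end TriplePartition

/-! ### Averaging over a group action -/

theorem MulAction.card_filter_smul_mem {Γ X : Type*} [Group Γ] [Fintype Γ] [DecidableEq X]
    [MulAction Γ X] (x : X) (S : Finset X) [DecidablePred (· ∈ MulAction.orbit Γ x)] :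
    (Finset.univ.filter fun h : Γ => h • x ∈ S).card =
      (S.filter (· ∈ MulAction.orbit Γ x)).card *
        (Finset.univ.filter fun h : Γ => h • x = x).card := by
  rw [Finset.card_eq_sum_card_fiberwise (f := fun h : Γ => h • x)
    (t := S.filter (· ∈ MulAction.orbit Γ x))
    (fun h hh => by simpa using hh), ← smul_eq_mul, ← Finset.sum_const]
  refine Finset.sum_congr rfl fun y hy => ?_
  obtain ⟨hy, g, rfl⟩ := Finset.mem_filter.1 hy
  -- The elements carrying `x` to `g • x` form the coset of the stabilizer through `g`.
  refine Finset.card_equiv (Equiv.mulLeft g⁻¹) fun h => ?_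
  simp only [Finset.mem_filter, Finset.mem_univ, true_and, Equiv.coe_mulLeft, mul_smul,
    inv_smul_eq_iff, and_iff_right_iff_imp]
  intro h'
  rwa [h']

/-- The probability that a random translate of `x` lies in `S`. -/
theorem MulAction.card_filter_smul_mem_div {Γ X : Type*} [Group Γ] [Fintype Γ] [DecidableEq X]
    [Fintype X] [MulAction Γ X] (x : X) (S : Finset X)
    [DecidablePred (· ∈ MulAction.orbit Γ x)] :
    ((Finset.univ.filter fun h : Γ => h • x ∈ S).card : ℚ) / Fintype.card Γ =
      (S.filter (· ∈ MulAction.orbit Γ x)).card /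
        (Finset.univ.filter (· ∈ MulAction.orbit Γ x)).card := by
  have h := card_filter_smul_mem (Γ := Γ) x Finset.univ
  simp only [Finset.mem_univ, Finset.filter_true, Finset.card_univ] at h
  have hpos : 0 < Fintype.card Γ := Fintype.card_pos
  rw [card_filter_smul_mem, h]
  rw [h] at hpos
  have h0 := right_ne_zero_of_mul hpos.ne'
  push_cast
  rw [mul_div_mul_right]
  exact_mod_cast h0

/-! ### Cliques and density equations -/

namespace TriplePartition
open Labelling

/-- Independent sets of size 70 meet every clique of size four in exactly one partition. -/
theorem card_filter_clique_eq_one {S : Finset TriplePartition}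
    (hS : triplePartitionGraph.IsIndepSet (S : Set TriplePartition)) (hcard : S.card = 70)
    {K : Fin 4 → TriplePartition} (hK : ∀ i j, i ≠ j → (K i).Skew (K j)) :
    (Finset.univ.filter fun i => K i ∈ S).card = 1 := by
  classical
  have hle : ∀ g : Equiv.Perm (Fin 9), (Finset.univ.filter fun i => g • K i ∈ S).card ≤ 1 := by
    intro g
    refine Finset.card_le_one.2 fun i hi j hj => ?_
    by_contra hij
    have hskew : triplePartitionGraph.Adj (g • K i) (g • K j) := skew_smul_iff.2 (hK i j hij)
    exact hS (by simpa using hi) (by simpa using hj) hskew.ne hskew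
  -- The quarter is 70/280, by transitivity.
  have hprob : ∀ i, ((Finset.univ.filter fun g : Equiv.Perm (Fin 9) => g • K i ∈ S).card : ℚ) =
      Fintype.card (Equiv.Perm (Fin 9)) / 4 := by
    intro i
    have h := MulAction.card_filter_smul_mem_div (Γ := Equiv.Perm (Fin 9)) (K i) S
    simp only [MulAction.orbit_eq_univ, Set.mem_univ, Finset.filter_true, Finset.card_univ,
      card_eq, hcard] at h
    have hpos : (0 : ℚ) < Fintype.card (Equiv.Perm (Fin 9)) := by
      exact_mod_cast Fintype.card_pos
    rw [div_eq_iff hpos.ne'] at h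
    rw [h]
    push_cast
    ring
  have hsum : ∑ g : Equiv.Perm (Fin 9), (Finset.univ.filter fun i => g • K i ∈ S).card =
      ∑ g : Equiv.Perm (Fin 9), 1 := by
    have : ∑ g : Equiv.Perm (Fin 9), (Finset.univ.filter fun i => g • K i ∈ S).card =
        ∑ i, (Finset.univ.filter fun g : Equiv.Perm (Fin 9) => g • K i ∈ S).card := by
      simp only [Finset.card_filter]
      exact Finset.sum_comm
    rw [this, ← Nat.cast_inj (R := ℚ)]
    push_cast
    rw [Finset.sum_congr rfl fun i _ => hprob i]
    simp only [Finset.sum_const, Finset.card_univ, Fintype.card_fin, nsmul_eq_mul]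
    push_cast
    ring
  -- Terms at most 1 with average 1 all equal 1; the identity gives the clique itself.
  have h1 := (Finset.sum_eq_sum_iff_of_le fun g _ => hle g).1 hsum 1 (Finset.mem_univ _)
  simpa using h1

/-- The proportion of members of `S` among the partitions whose meet with `P` has `k` cells. -/
def density (S : Finset TriplePartition) (P : TriplePartition) (k : ℕ) : ℚ :=
  (S.filter fun Q => meetCells P Q = k).card /
    (Finset.univ.filter fun Q => meetCells P Q = k).card

/-- Under a random element of the stabilizer of `P`, `K i` is uniform on its orbit, so its density
is the probability of landing in `S`. Every translated clique meets `S` once, so these probabilities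
sum to 1. -/
theorem sum_density_clique {S : Finset TriplePartition}
    (hS : triplePartitionGraph.IsIndepSet (S : Set TriplePartition)) (hcard : S.card = 70)
    (P : TriplePartition) {K : Fin 4 → TriplePartition} (hK : ∀ i j, i ≠ j → (K i).Skew (K j)) :
    ∑ i, density S P (meetCells P (K i)) = 1 := by
  classical
  have hprob : ∀ i, density S P (meetCells P (K i)) = ((Finset.univ.filter
      fun h : MulAction.stabilizer (Equiv.Perm (Fin 9)) P => h • K i ∈ S).card : ℚ) /
      Fintype.card (MulAction.stabilizer (Equiv.Perm (Fin 9)) P) := by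
    intro i
    rw [MulAction.card_filter_smul_mem_div]
    simp only [mem_orbit_stabilizer_iff]
    rfl
  have hone : ∀ h : MulAction.stabilizer (Equiv.Perm (Fin 9)) P,
      (Finset.univ.filter fun i => h • K i ∈ S).card = 1 := fun h =>
    card_filter_clique_eq_one hS hcard fun i j hij => skew_smul_iff.2 (hK i j hij)
  have hsum : ∑ i, (Finset.univ.filter
      fun h : MulAction.stabilizer (Equiv.Perm (Fin 9)) P => h • K i ∈ S).card =
      Fintype.card (MulAction.stabilizer (Equiv.Perm (Fin 9)) P) := by
    rw [← Finset.card_univ, Finset.card_eq_sum_ones, ← Finset.sum_congr rfl fun h _ => hone h]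
    simp only [Finset.card_filter]
    exact Finset.sum_comm
  rw [Finset.sum_congr rfl fun i _ => hprob i, ← Finset.sum_div, ← Nat.cast_sum, hsum, div_self]
  exact_mod_cast Fintype.card_pos.ne'

/-- Moving `P` to `base` makes the meet sizes computable for explicit cliques. -/
theorem sum_density_labelling {S : Finset TriplePartition}
    (hS : triplePartitionGraph.IsIndepSet (S : Set TriplePartition)) (hcard : S.card = 70)
    (P : TriplePartition) (K : Fin 4 → Labelling)
    (hK : ∀ i j, i ≠ j → ∀ k l, overlap (K i) (K j) k l = 1) :
    ∑ i, density S P (Finset.univ.image fun x => (base.1 x, (K i).1 x)).card = 1 := by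
  obtain ⟨g, rfl⟩ := MulAction.exists_smul_eq (Equiv.Perm (Fin 9)) base.toPartition P
  rw [← sum_density_clique hS hcard (g • base.toPartition) (K := fun i => g • (K i).toPartition)
    fun i j hij => skew_smul_iff.2 (skew_iff.2 (hK i j hij))]
  simp only [meetCells_smul, meetCells_toPartition]

theorem density_relations {S : Finset TriplePartition}
    (hS : triplePartitionGraph.IsIndepSet (S : Set TriplePartition)) (hcard : S.card = 70)
    (P : TriplePartition) :
    3 * density S P 6 + density S P 9 = 1 ∧ density S P 6 + 3 * density S P 7 = 1 ∧
      density S P 5 + 2 * density S P 7 + density S P 9 = 1 := by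
  have h1 := sum_density_labelling hS hcard P
    ![⟨![0, 0, 1, 0, 2, 2, 1, 1, 2], by decide⟩, ⟨![0, 1, 0, 2, 0, 2, 1, 2, 1], by decide⟩,
      ⟨![0, 1, 1, 2, 2, 1, 2, 0, 0], by decide⟩, ⟨![0, 1, 2, 2, 1, 0, 0, 1, 2], by decide⟩]
    (by decide +kernel)
  have h2 := sum_density_labelling hS hcard P
    ![⟨![0, 1, 0, 2, 2, 0, 1, 1, 2], by decide⟩, ⟨![0, 0, 1, 0, 1, 2, 1, 2, 2], by decide⟩,
      ⟨![0, 1, 1, 2, 0, 2, 2, 0, 1], by decide⟩, ⟨![0, 1, 2, 2, 1, 1, 0, 2, 0], by decide⟩]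
    (by decide +kernel)
  have h3 := sum_density_labelling hS hcard P
    ![⟨![0, 0, 0, 1, 1, 2, 1, 2, 2], by decide⟩, ⟨![0, 1, 2, 0, 1, 0, 2, 1, 2], by decide⟩,
      ⟨![0, 1, 2, 1, 2, 2, 0, 0, 1], by decide⟩, ⟨![0, 1, 2, 2, 0, 1, 1, 2, 0], by decide⟩]
    (by decide +kernel)
  rw [Fin.sum_univ_four] at h1 h2 h3
  -- The meet sizes of the explicit labellings with `base` are evaluated by reduction.
  change density S P 6 + density S P 6 + density S P 6 + density S P 9 = 1 at h1
  change density S P 6 + density S P 7 + density S P 7 + density S P 7 = 1 at h2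
  change density S P 5 + density S P 7 + density S P 7 + density S P 9 = 1 at h3
  exact ⟨by linarith, by linarith, by linarith⟩

theorem density_nine_eq_zero {S : Finset TriplePartition}
    (hS : triplePartitionGraph.IsIndepSet (S : Set TriplePartition)) {P : TriplePartition}
    (hP : P ∈ S) : density S P 9 = 0 := by
  have : S.filter (fun Q => meetCells P Q = 9) = ∅ := by
    refine Finset.filter_eq_empty_iff.2 fun Q hQ h => ?_
    have hadj : triplePartitionGraph.Adj P Q := meetCells_eq_nine_iff_skew.1 h
    exact hS hP hQ hadj.ne hadj
  rw [density, this, Finset.card_empty, Nat.cast_zero, zero_div]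

end TriplePartition

open TriplePartition in
theorem mainTheorem7 (S : Finset TriplePartition)
    (hS : triplePartitionGraph.IsIndepSet (S : Set TriplePartition)) (hcard : S.card = 70)
    (π : TriplePartition) (hπ : π ∈ S) :
    (S.filter (fun σ => meetCells π σ = 7)).card = 36 ∧
    (S.filter (fun σ => meetCells π σ = 6)).card = 18 ∧
    (S.filter (fun σ => meetCells π σ = 5)).card = 15 := by
  obtain ⟨h1, h2, h3⟩ := density_relations hS hcard π
  rw [density_nine_eq_zero hS hπ] at h1 h3
  have h6 : density S π 6 = 1 / 3 := by linarith
  have h7 : density S π 7 = 2 / 9 := by linarith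
  have h5 : density S π 5 = 5 / 9 := by linarith
  rw [density, card_meetCells_eq_six, div_eq_iff (by norm_num)] at h6
  rw [density, card_meetCells_eq_seven, div_eq_iff (by norm_num)] at h7
  rw [density, card_meetCells_eq_five, div_eq_iff (by norm_num)] at h5
  norm_num at h5 h6 h7
  exact ⟨by exact_mod_cast h7, by exact_mod_cast h6, by exact_mod_cast h5⟩
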